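/- Let $(\Omega,m)$ be a measure space (for instance a $\sigma$-finite one), and let $L_p(m)$ denote the real Lebesgue spaces, with $\langle\cdot,\cdot\rangle$ the inner product of $L_2(m)$. Let $T_0$ and $T$ be positive $C_0$-semigroups on $L_2(m)$ with generators $A_0$ and $A$. Assume that for all $t\ge 0$ $$\|T(t)u\|_1\le\|u\|_1\quad(u\in L_2(m)\cap L_1(m)),\qquad \|T_0(t)^*v\|_1\le\|v\|_1\quad(v\in L_2(m)\cap L_1(m)).$$ Let $C\ge 0$. Call $\lambda\in\mathbb R$ *admissible* if there are $\omega<\lambda$ and $M$ such that $\|T(t)\|_{L(L_2(m))}\le Me^{\omega t}$ for all $t\ge0$, and likewise (with possibly different $\omega<\lambda$ and $M$) for $T_0$. Then every admissible $\lambda$ lies in $\varrho(A)\cap\varrho(A_0)$, and the following are equivalent: (a) For all $t\ge0$ and $0\le u\in L_2(m)\cap L_1(m)$, $$T(t)u\le T_0(t)u+Ct\,\|u\|_1\mathbf 1_\Omega .$$ (b) For all $0\le u\in D(A)\cap L_1(m)$ and $0\le v\in D(A_0^*)\cap L_1(m)$, $$\langle Au,v\rangle\le\langle u,A_0^*v\rangle+C\|u\|_1\|v\|_1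 .$$ (c) For all admissible $\lambda>0$ and all $0\le u\in L_2(m)\cap L_1(m)$, $$(\lambda-A)^{-1}u\le(\lambda-A_0)^{-1}u+\frac{C}{\lambda^2}\|u\|_1\mathbf 1_\Omega .$$ (c') For all $\lambda>0$ and all $0\le u\in L_2(m)\cap L_1(m)$, the inequality $$R_\lambda u\le R^0_\lambda u+\frac{C}{\lambda^2}\|u\|_1\mathbf 1_\Omega$$ holds almost everywhere, where $R_\lambda u$ and $R^0_\lambda u$ are the $[0,\infty]$-valued functions $\sup_{n\in\mathbb N}\int_0^n e^{-\lambda t}T(t)u\,dt$ and $\sup_{n\in\mathbb N}\int_0^n e^{-\lambda t}T_0(t)u\,dt$. -/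

import Mathlib

open MeasureTheory Filter Topology
open scoped NNReal ENNReal

/-- A strongly continuous one-parameter semigroup of bounded linear operators on the real normed
space `X`, indexed by the time set `[0, ∞)`. -/
structure C0Semigroup (X : Type*) [NormedAddCommGroup X] [NormedSpace ℝ X] where
  op : ℝ≥0 → X →L[ℝ] X
  op_zero : op 0 = ContinuousLinearMap.id ℝ X
  op_add : ∀ s t : ℝ≥0, op (s + t) = (op s).comp (op t)
  tendsto_op : ∀ u : X, Tendsto (fun t : ℝ≥0 => op t u) (𝓝 0) (𝓝 u)

namespace C0Semigroup

section Banach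

variable {X : Type*} [NormedAddCommGroup X] [NormedSpace ℝ X]

/-- The difference quotient `t⁻¹ (T(t) u - u)`. -/
noncomputable def diffQuot (T : C0Semigroup X) (u : X) (t : ℝ≥0) : X :=
  (t : ℝ)⁻¹ • (T.op t u - u)

/-- The generator `A` of `T`: its domain consists of all `u` for which `t⁻¹ (T(t) u - u)` converges
as `t → 0+`, and `A u` is the limit. -/
noncomputable def generator (T : C0Semigroup X) : X →ₗ.[ℝ] X where
  domain :=
    { carrier := {u | ∃ y, Tendsto (T.diffQuot u) (𝓝[>] 0) (𝓝 y)}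
      zero_mem' := ⟨0, by
        have h : T.diffQuot 0 = fun _ => 0 := by ext t; simp [diffQuot]
        rw [h]; exact tendsto_const_nhds⟩
      add_mem' := by
        rintro u v ⟨y, hy⟩ ⟨z, hz⟩
        refine ⟨y + z, (hy.add hz).congr fun t => ?_⟩
        simp only [diffQuot, map_add, ← smul_add]
        congr 1; abel
      smul_mem' := by
        rintro c u ⟨y, hy⟩
        refine ⟨c • y, (hy.const_smul c).congr fun t => ?_⟩
        simp only [diffQuot, map_smul, ← smul_sub]
        exact smul_comm _ _ _ }
  toFun :=
    { toFun := fun u => u.2.choose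
      map_add' := by
        intro u v
        refine tendsto_nhds_unique (u + v).2.choose_spec
          ((u.2.choose_spec.add v.2.choose_spec).congr fun t => ?_)
        simp only [diffQuot, Submodule.coe_add, map_add, ← smul_add]
        congr 1; abel
      map_smul' := by
        intro c u
        refine tendsto_nhds_unique (c • u).2.choose_spec
          ((u.2.choose_spec.const_smul c).congr fun t => ?_)
        simp only [diffQuot, Submodule.coe_smul, map_smul, ← smul_sub]
        exact smul_comm _ _ _ }

theorem tendsto_generator (T : C0Semigroup X) (u : T.generator.domain) :
    Tendsto (T.diffQuot (u : X)) (𝓝[>] 0) (𝓝 (T.generator u)) :=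
  u.2.choose_spec

/-- `l` lies strictly above the exponential growth bound of `T` in the operator norm of `X`:
for some `ω < l` and some `M` we have `‖T(t)‖ ≤ M e^{ω t}` for all `t ≥ 0`. -/
def GrowthBoundLT (T : C0Semigroup X) (l : ℝ) : Prop :=
  ∃ ω : ℝ, ω < l ∧ ∃ M : ℝ, ∀ t : ℝ≥0, ‖T.op t‖ ≤ M * Real.exp (ω * t)

end Banach

end C0Semigroup

section Resolvent

variable {X : Type*} [NormedAddCommGroup X] [NormedSpace ℝ X]

/-- The bounded operator `R` on `X` is the two-sided inverse of `l - A : D(A) → X`. -/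
def IsResolventOp (A : X →ₗ.[ℝ] X) (l : ℝ) (R : X →L[ℝ] X) : Prop :=
  (∀ u : X, ∃ w : A.domain, (w : X) = R u ∧ l • (w : X) - A w = u) ∧
    ∀ w : A.domain, R (l • (w : X) - A w) = w

/-- The real part of the resolvent set: all real `l` such that `l - A : D(A) → X` is bijective with
bounded inverse. -/
def realResolventSet (A : X →ₗ.[ℝ] X) : Set ℝ := {l | ∃ R, IsResolventOp A l R}

open scoped Classical in
/-- The resolvent `(l - A)⁻¹` (the value is `0` outside of the resolvent set). -/
noncomputable def resolventOp (A : X →ₗ.[ℝ] X) (l : ℝ) : X →L[ℝ] X :=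
  if h : l ∈ realResolventSet A then h.choose else 0

theorem isResolventOp_resolventOp {A : X →ₗ.[ℝ] X} {l : ℝ} (h : l ∈ realResolventSet A) :
    IsResolventOp A l (resolventOp A l) := by
  rw [resolventOp, dif_pos h]; exact h.choose_spec

end Resolvent

section L2

variable {Ω : Type*} [MeasurableSpace Ω] {m : Measure Ω}

/-- `T` is a positive semigroup: `T(t) u ≥ 0` for all `t ≥ 0` and `u ≥ 0`. -/
def C0Semigroup.IsPositive (T : C0Semigroup (Lp ℝ 2 m)) : Prop :=
  ∀ (t : ℝ≥0) (u : Lp ℝ 2 m), 0 ≤ u → 0 ≤ T.op t u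

/-- The norm `‖u‖₁` of `u ∈ L₂(m)`; it is used only for `u ∈ L₁(m)`. -/
noncomputable def normL1 (u : Lp ℝ 2 m) : ℝ := (eLpNorm u 1 m).toReal

/-- The bounded operator `B` on `L₂(m)` maps `L₂(m) ∩ L₁(m)` contractively into itself with respect
to `‖·‖₁`. (The inequality in `[0, ∞]` includes that `B u` belongs to `L₁(m)`.) -/
def IsL1Contraction (B : Lp ℝ 2 m →L[ℝ] Lp ℝ 2 m) : Prop :=
  ∀ u : Lp ℝ 2 m, MemLp u 1 m → eLpNorm (B u) 1 m ≤ eLpNorm u 1 m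

/-- The monotone limit, as `n → ∞`, of the truncated Laplace transforms
`∫₀ⁿ e^{-l t} T(t) u dt ∈ L₂(m)`, as a `[0, ∞]`-valued function on `Ω`; it is used only for positive
`T` and `u ≥ 0`, when the truncated transforms are nonnegative and increase with `n`. -/
noncomputable def C0Semigroup.laplaceLimit (T : C0Semigroup (Lp ℝ 2 m)) (l : ℝ)
    (u : Lp ℝ 2 m) (x : Ω) : ℝ≥0∞ :=
  ⨆ n : ℕ, ENNReal.ofReal
    ((∫ t in (0 : ℝ)..n, Real.exp (-l * t) • T.op t.toNNReal u : Lp ℝ 2 m) x)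

end L2

/-! The core is the passage from the generators back to the semigroups. Formally, the derivative of
s ↦ ⟨T₀(t-s)T(s)u, v⟩ is ⟨AT(s)u, T₀(t-s)*v⟩ - ⟨T(s)u, A₀*T₀(t-s)*v⟩, which the generator estimate
and the two L₁ contractivities bound by C‖u‖₁‖v‖₁; it remains to integrate over [0,t]. Since T(s)u
need not lie in D(A₀), `inner_resolventOp_op_le` inserts R = (l - A₀)⁻¹ between the semigroups: R*
maps into D(A₀*), and ‖R*w‖₁ ≤ ‖w‖₁/l for 0 ≤ w in L₁. After multiplication by l, R disappears as l
→ ∞, because l(l - A₀)⁻¹ → I strongly (`tendsto_smul_resolventOp`). The same approximation, applied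
to A, removes the restriction u ∈ D(A).

The remaining implications rest on the Laplace transform. The identity ∫₀^∞ t e^{-lt} dt = 1/l²
turns Ct into C/l² (`laplaceLimit_le_of_op_le`); conversely, l² times the resolvent estimate becomes
the generator estimate as l → ∞ (`inner_generator_le_of_resolventOp_le`). Pointwise bounds are
tested against 0 ≤ v in L₁ ∩ L₂ (`ae_le_add_of_inner_le`). Level sets {f > ε} of L₂ functions have
finite measure, so σ-finiteness plays no role. -/

theorem tendsto_clm_apply_of_bounded {ι X Y : Type*} [NormedAddCommGroup X] [NormedSpace ℝ X]
    [NormedAddCommGroup Y] [NormedSpace ℝ Y] {f : Filter ι} {K : ι → X →L[ℝ] Y} {y : ι → X}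
    {x : X} {z : Y} {B : ℝ} (hB : ∀ᶠ i in f, ‖K i‖ ≤ B) (hK : Tendsto (fun i => K i x) f (𝓝 z))
    (hy : Tendsto y f (𝓝 x)) : Tendsto (fun i => K i (y i)) f (𝓝 z) := by
  have h : Tendsto (fun i => K i (y i - x)) f (𝓝 0) := by
    refine squeeze_zero_norm' (a := fun i => B * ‖y i - x‖) ?_ ?_
    · filter_upwards [hB] with i hi
      exact (K i).le_of_opNorm_le hi _
    · simpa using (tendsto_iff_norm_sub_tendsto_zero.1 hy).const_mul B
  simpa using hK.add h

/-! ### Exponential bounds, orbits and the Laplace transform as resolvent -/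

namespace C0Semigroup

section Banach

variable {X : Type*} [NormedAddCommGroup X] [NormedSpace ℝ X] (T : C0Semigroup X)

theorem op_add_apply (s t : ℝ≥0) (u : X) : T.op (s + t) u = T.op s (T.op t u) := by
  rw [T.op_add]; rfl

theorem op_comm (s t : ℝ≥0) (u : X) : T.op s (T.op t u) = T.op t (T.op s u) := by
  rw [← T.op_add_apply, ← T.op_add_apply, add_comm]

theorem GrowthBoundLT.const_nonneg {T : C0Semigroup X} {ω M : ℝ}
    (h : ∀ t : ℝ≥0, ‖T.op t‖ ≤ M * Real.exp (ω * t)) : 0 ≤ M := by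
  have := (norm_nonneg _).trans (h 0)
  simpa using this

/-- Otherwise ‖T(sₙ)‖ > n along some sₙ → 0, while each T(sₙ)u converges and so is bounded,
contradicting uniform boundedness. -/
theorem exists_bound_near_zero [CompleteSpace X] :
    ∃ δ : ℝ≥0, 0 < δ ∧ ∃ K : ℝ, ∀ t ≤ δ, ‖T.op t‖ ≤ K := by
  by_contra! H
  choose s hs hs' using fun n : ℕ => H (1 / ((n : ℝ≥0) + 1)) (by positivity) n
  have hs0 : Tendsto s atTop (𝓝 0) :=
    tendsto_of_tendsto_of_tendsto_of_le_of_le tendsto_const_nhds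
      (by simpa using tendsto_one_div_add_atTop_nhds_zero_nat (𝕜 := ℝ≥0)) (fun _ => zero_le) hs
  obtain ⟨K, hK⟩ := banach_steinhaus (g := fun n => T.op (s n)) fun u => by
    obtain ⟨c, hc⟩ := ((T.tendsto_op u).comp hs0).norm.bddAbove_range
    exact ⟨c, fun n => hc ⟨n, rfl⟩⟩
  obtain ⟨n, hn⟩ := exists_nat_gt K
  exact absurd (hK n) (not_le.2 (hn.trans (hs' n)))

theorem exists_exp_bound [CompleteSpace X] :
    ∃ ω M : ℝ, ∀ t : ℝ≥0, ‖T.op t‖ ≤ M * Real.exp (ω * t) := by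
  obtain ⟨δ, hδ, K, hK⟩ := T.exists_bound_near_zero
  set L := max K 1 with hL
  have hL1 : 1 ≤ L := le_max_right _ _
  have hL0 : 0 < L := one_pos.trans_le hL1
  have hn : ∀ (n : ℕ) (t : ℝ≥0), t ≤ n * δ → ‖T.op t‖ ≤ L ^ n * L := by
    intro n
    induction n with
    | zero =>
      intro t ht
      rw [pow_zero, one_mul]
      exact (hK t ((by simpa using ht : t = 0) ▸ hδ.le)).trans (le_max_left K 1)
    | succ n ih =>
      intro t ht
      rcases le_total t δ with h | h
      · refine ((hK t h).trans (le_max_left K 1)).trans ?_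
        exact le_mul_of_one_le_left hL0.le (one_le_pow₀ hL1)
      · obtain ⟨r, rfl⟩ := exists_add_of_le h
        have hr : r ≤ n * δ := by
          have : δ + r ≤ δ + n * δ := by
            refine ht.trans_eq ?_
            push_cast
            ring
          exact le_of_add_le_add_left this
        rw [T.op_add]
        refine (ContinuousLinearMap.opNorm_comp_le _ _).trans ?_
        calc _ ≤ L * (L ^ n * L) :=
              mul_le_mul ((hK δ le_rfl).trans (le_max_left _ _)) (ih r hr) (norm_nonneg _) hL0.le
          _ = _ := by ring
  -- `hn` is used with n = ⌊t/δ⌋ + 1; the rounding up costs one factor L, the remainder of length at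
  -- most δ the other.
  refine ⟨Real.log L / δ, L * L, fun t => ?_⟩
  have hδ' : (0 : ℝ) < δ := hδ
  have ht : t ≤ (⌊(t / δ : ℝ≥0)⌋₊ + 1 : ℕ) * δ := by
    have := (Nat.lt_floor_add_one (t / δ)).le
    push_cast
    exact (div_le_iff₀ hδ).1 this
  refine (hn _ t ht).trans ?_
  have h1 : (⌊(t / δ : ℝ≥0)⌋₊ : ℝ) ≤ t / δ := by
    exact_mod_cast Nat.floor_le (zero_le (a := t / δ))
  have h2 : L ^ ⌊(t / δ : ℝ≥0)⌋₊ ≤ Real.exp (Real.log L / δ * t) := by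
    rw [← Real.exp_log (pow_pos hL0 _), Real.log_pow]
    refine Real.exp_le_exp.2 ?_
    calc _ ≤ (t / δ : ℝ) * Real.log L := mul_le_mul_of_nonneg_right h1 (Real.log_nonneg hL1)
      _ = _ := by ring
  rw [pow_succ]
  nlinarith [mul_le_mul_of_nonneg_right h2 (mul_pos hL0 hL0).le]

theorem eventually_growthBoundLT [CompleteSpace X] : ∀ᶠ l : ℝ in atTop, T.GrowthBoundLT l := by
  obtain ⟨ω, M, h⟩ := T.exists_exp_bound
  filter_upwards [eventually_gt_atTop ω] with l hl
  exact ⟨ω, hl, M, h⟩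

theorem exists_bound [CompleteSpace X] (t₀ : ℝ≥0) : ∃ B : ℝ, ∀ t ≤ t₀, ‖T.op t‖ ≤ B := by
  obtain ⟨ω, M, h⟩ := T.exists_exp_bound
  have hM := GrowthBoundLT.const_nonneg h
  refine ⟨M * Real.exp (|ω| * t₀), fun t ht => (h t).trans ?_⟩
  gcongr
  exact le_abs_self ω

theorem continuous_op [CompleteSpace X] (u : X) : Continuous fun t => T.op t u := by
  refine continuous_iff_continuousAt.2 fun t => ?_
  obtain ⟨B, hB⟩ := T.exists_bound t
  refine tendsto_iff_norm_sub_tendsto_zero.2 ?_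
  have hd : Tendsto (fun s => nndist s t) (𝓝 t) (𝓝 0) := by
    have : Continuous fun s : ℝ≥0 => nndist s t := by fun_prop
    simpa using this.tendsto t
  have h0 : Tendsto (fun s => B * ‖T.op (nndist s t) u - u‖) (𝓝 t) (𝓝 0) := by
    simpa using (tendsto_iff_norm_sub_tendsto_zero.1 ((T.tendsto_op u).comp hd)).const_mul B
  refine squeeze_zero (fun _ => norm_nonneg _) (fun s => ?_) h0
  -- Factoring out T(min(s,t)) treats both sides of t at once and leaves continuity at 0.
  have key : ∀ a b : ℝ≥0, a ≤ t → ‖T.op (a + b) u - T.op a u‖ ≤ B * ‖T.op b u - u‖ := by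
    intro a b ha
    rw [T.op_add_apply, ← map_sub]
    exact (T.op a).le_of_opNorm_le (hB a ha) _
  have hnn : ∀ a b : ℝ≥0, nndist (a + b) a = b := by
    intro a b
    ext
    rw [coe_nndist, NNReal.dist_eq]
    simp
  rcases le_total s t with h | h
  · obtain ⟨b, rfl⟩ := exists_add_of_le h
    rw [nndist_comm, hnn, norm_sub_rev]
    exact key s b h
  · obtain ⟨b, rfl⟩ := exists_add_of_le h
    rw [hnn]
    exact key t b le_rfl

/-- The orbit of `u`, as a function on the real line that is constant on `(-∞, 0]`. -/
noncomputable def orbit (u : X) (t : ℝ) : X := T.op t.toNNReal u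

theorem continuous_orbit [CompleteSpace X] (u : X) : Continuous (T.orbit u) :=
  (T.continuous_op u).comp continuous_real_toNNReal

theorem orbit_zero (u : X) : T.orbit u 0 = u := by simp [orbit, T.op_zero]

theorem orbit_coe (u : X) (t : ℝ≥0) : T.orbit u t = T.op t u := by simp [orbit]

theorem op_orbit (u : X) (h : ℝ≥0) {t : ℝ} (ht : 0 ≤ t) : 
    T.op h (T.orbit u t) = T.orbit u (t + h) := by
  rw [orbit, orbit, ← T.op_add_apply, Real.toNNReal_add ht (NNReal.coe_nonneg h), add_comm,
    Real.toNNReal_coe]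

theorem op_mem_domain (u : T.generator.domain) (t : ℝ≥0) :
    ∃ w : T.generator.domain, (w : X) = T.op t u ∧ T.generator w = T.op t (T.generator u) := by
  have h : Tendsto (T.diffQuot (T.op t u)) (𝓝[>] 0) (𝓝 (T.op t (T.generator u))) := by
    refine (((T.op t).continuous.tendsto _).comp (T.tendsto_generator u)).congr fun s => ?_
    simp only [diffQuot, Function.comp, map_smul, map_sub]
    rw [T.op_comm]
  exact ⟨⟨T.op t u, _, h⟩, rfl, tendsto_nhds_unique (T.tendsto_generator _) h⟩

theorem tendsto_coe_nhdsGT_zero : Tendsto (fun t : ℝ≥0 => (t : ℝ)) (𝓝[>] 0) (𝓝[>] 0) := by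
  refine tendsto_nhdsWithin_iff.2 ⟨?_, ?_⟩
  · exact (NNReal.continuous_coe.tendsto' 0 0 rfl).mono_left nhdsWithin_le_nhds
  · filter_upwards [self_mem_nhdsWithin] with t ht
    exact NNReal.coe_pos.2 ht

theorem tendsto_toNNReal_nhdsGT_zero : Tendsto Real.toNNReal (𝓝[>] 0) (𝓝[>] 0) := by
  refine tendsto_nhdsWithin_iff.2 ⟨?_, ?_⟩
  · exact (continuous_real_toNNReal.tendsto' 0 0 (by simp)).mono_left nhdsWithin_le_nhds
  · filter_upwards [self_mem_nhdsWithin] with t ht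
    exact Real.toNNReal_pos.2 ht

theorem hasDerivWithinAt_orbit (u : T.generator.domain) {t : ℝ} (ht : 0 ≤ t) :
    HasDerivWithinAt (T.orbit u) (T.orbit (T.generator u) t) (Set.Ioi t) t := by
  rw [hasDerivWithinAt_iff_tendsto_slope' (by simp)]
  have h1 : Tendsto (fun s : ℝ => (s - t).toNNReal) (𝓝[>] t) (𝓝[>] 0) := by
    refine tendsto_toNNReal_nhdsGT_zero.comp ?_
    refine tendsto_nhdsWithin_iff.2 ⟨?_, ?_⟩
    · exact ((continuous_sub_right t).tendsto' t 0 (by simp)).mono_left nhdsWithin_le_nhds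
    · filter_upwards [self_mem_nhdsWithin] with s hs
      exact sub_pos.2 (Set.mem_Ioi.1 hs)
  have h2 := (((T.op t.toNNReal).continuous.tendsto _).comp (T.tendsto_generator u)).comp h1
  refine h2.congr' ?_
  filter_upwards [self_mem_nhdsWithin] with s hs
  have hs' : t ≤ s := le_of_lt hs
  simp only [Function.comp, diffQuot, slope_def_module, map_smul, map_sub]
  rw [T.op_comm, ← orbit, ← orbit]
  have h3 := T.op_orbit (u : X) (s - t).toNNReal ht
  rw [Real.coe_toNNReal _ (sub_nonneg.2 hs'), add_sub_cancel] at h3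
  rw [Real.coe_toNNReal _ (sub_nonneg.2 hs'), ← h3]
  rfl

/-- The right derivative is continuous, so the orbit is its integral, and the fundamental theorem of
calculus makes the derivative two-sided. -/
theorem hasDerivAt_orbit [CompleteSpace X] (u : T.generator.domain) {t : ℝ} (ht : 0 < t) :
    HasDerivAt (T.orbit u) (T.orbit (T.generator u) t) t := by
  have hc := T.continuous_orbit (T.generator u)
  have h1 : ∀ s : ℝ, 0 ≤ s → ∫ r in (0 : ℝ)..s, T.orbit (T.generator u) r = T.orbit u s - u := by
    intro s hs
    rw [intervalIntegral.integral_eq_sub_of_hasDeriv_right (f := T.orbit u)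
      (T.continuous_orbit u).continuousOn ?_ (hc.intervalIntegrable _ _), orbit_zero]
    intro r hr
    rw [min_eq_left hs] at hr
    exact T.hasDerivWithinAt_orbit u hr.1.le
  have h2 : HasDerivAt (fun s => u + ∫ r in (0 : ℝ)..s, T.orbit (T.generator u) r)
      (T.orbit (T.generator u) t) t := (hc.integral_hasStrictDerivAt 0 t).hasDerivAt.const_add _
  refine h2.congr_of_eventuallyEq ?_
  filter_upwards [lt_mem_nhds ht] with s hs
  rw [h1 s hs.le, add_sub_cancel]

theorem integrableOn_laplace [CompleteSpace X] {l : ℝ} (hl : T.GrowthBoundLT l) (u : X) :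
    IntegrableOn (fun t : ℝ => Real.exp (-l * t) • T.orbit u t) (Set.Ioi 0) := by
  obtain ⟨ω, hω, M, h⟩ := hl
  have hc : Continuous fun t : ℝ => Real.exp (-l * t) • T.orbit u t :=
    Continuous.smul (by fun_prop) (T.continuous_orbit u)
  refine Integrable.mono' ((integrableOn_exp_mul_Ioi (sub_neg.2 hω) 0).const_mul (M * ‖u‖))
    hc.aestronglyMeasurable ?_
  refine (ae_restrict_mem measurableSet_Ioi).mono fun t ht => ?_
  have h1 := (T.op t.toNNReal).le_of_opNorm_le (h _) u
  rw [Real.coe_toNNReal _ (le_of_lt ht)] at h1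
  rw [norm_smul, Real.norm_of_nonneg (Real.exp_pos _).le]
  calc _ ≤ Real.exp (-l * t) * (M * Real.exp (ω * t) * ‖u‖) := by gcongr; exact h1
    _ = M * ‖u‖ * Real.exp ((ω - l) * t) := by
      rw [show (ω - l) * t = -l * t + ω * t by ring, Real.exp_add]; ring

/-- Translation of the integration variable by h. The right-hand side is visibly differentiable at h
= 0, which is how the Laplace transform is seen to take values in the domain. -/
theorem op_laplace [CompleteSpace X] {l : ℝ} (hl : T.GrowthBoundLT l) (u : X) (h : ℝ≥0) :
    T.op h (∫ t in Set.Ioi (0 : ℝ), Real.exp (-l * t) • T.orbit u t) =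
      Real.exp (l * h) • ((∫ t in Set.Ioi (0 : ℝ), Real.exp (-l * t) • T.orbit u t) -
        ∫ t in (0 : ℝ)..h, Real.exp (-l * t) • T.orbit u t) := by
  have hi := T.integrableOn_laplace hl u
  have hh : (0 : ℝ) ≤ h := h.2
  have h1 : (∫ t in (0 : ℝ)..h, Real.exp (-l * t) • T.orbit u t) +
      ∫ t in Set.Ioi (h : ℝ), Real.exp (-l * t) • T.orbit u t =
        ∫ t in Set.Ioi (0 : ℝ), Real.exp (-l * t) • T.orbit u t :=
    intervalIntegral.integral_interval_add_Ioi hi (hi.mono_set (Set.Ioi_subset_Ioi hh))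
  have h2 := (measurePreserving_add_right volume (h : ℝ)).setIntegral_preimage_emb
    (measurableEmbedding_addRight (h : ℝ))
    (fun t => Real.exp (l * h) • Real.exp (-l * t) • T.orbit u t) (Set.Ioi (h : ℝ))
  rw [Set.preimage_add_const_Ioi, sub_self] at h2
  rw [← h1, add_sub_cancel_left, h1, ← (T.op h).integral_comp_comm hi, ← integral_smul, ← h2]
  refine setIntegral_congr_fun measurableSet_Ioi fun t ht => ?_
  simp only [map_smul, smul_smul]
  rw [T.op_orbit _ _ (le_of_lt ht), ← Real.exp_add]
  congr 2
  ring

theorem tendsto_diffQuot_of_hasDerivAt {u y : X} {G : ℝ → X} (hG : HasDerivAt G y 0)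
    (h : ∀ t : ℝ≥0, T.op t u = G t) : Tendsto (T.diffQuot u) (𝓝[>] 0) (𝓝 y) := by
  have h0 : u = G 0 := by simpa [T.op_zero] using h 0
  have h1 := (hasDerivWithinAt_iff_tendsto_slope' (by simp)).1 (hG.hasDerivWithinAt (s := Set.Ioi 0))
  refine (h1.comp tendsto_coe_nhdsGT_zero).congr fun t => ?_
  simp only [Function.comp, slope_def_module, diffQuot, sub_zero]
  rw [h t, ← h0]

theorem exists_isResolventOp [CompleteSpace X] {l : ℝ} (hl : T.GrowthBoundLT l) :
    ∃ R : X →L[ℝ] X, IsResolventOp T.generator l R ∧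
      ∀ u, R u = ∫ t in Set.Ioi (0 : ℝ), Real.exp (-l * t) • T.orbit u t := by
  have hi := T.integrableOn_laplace hl
  obtain ⟨ω, hω, M, hM⟩ := id hl
  have hb : ∀ (u : X) (t : ℝ), 0 ≤ t →
      ‖Real.exp (-l * t) • T.orbit u t‖ ≤ M * Real.exp ((ω - l) * t) * ‖u‖ := by
    intro u t ht
    have h1 := (T.op t.toNNReal).le_of_opNorm_le (hM _) u
    rw [Real.coe_toNNReal _ ht] at h1
    rw [norm_smul, Real.norm_of_nonneg (Real.exp_pos _).le]
    calc _ ≤ Real.exp (-l * t) * (M * Real.exp (ω * t) * ‖u‖) := by gcongr; exact h1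
      _ = M * Real.exp ((ω - l) * t) * ‖u‖ := by
        rw [show (ω - l) * t = -l * t + ω * t by ring, Real.exp_add]; ring
  let R₀ : X →ₗ[ℝ] X :=
    { toFun := fun u => ∫ t in Set.Ioi (0 : ℝ), Real.exp (-l * t) • T.orbit u t
      map_add' := by
        intro u v
        rw [← integral_add (hi u) (hi v)]
        simp only [orbit, map_add, smul_add]
      map_smul' := by
        intro c u
        rw [RingHom.id_apply, ← integral_smul]
        simp only [orbit, map_smul]
        simp only [smul_comm c] }
  let R : X →L[ℝ] X := R₀.mkContinuous (∫ t in Set.Ioi (0 : ℝ), M * Real.exp ((ω - l) * t)) <| by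
    intro u
    rw [← integral_mul_const]
    refine norm_integral_le_of_norm_le
      (((integrableOn_exp_mul_Ioi (sub_neg.2 hω) 0).const_mul M).mul_const _) ?_
    exact (ae_restrict_mem measurableSet_Ioi).mono fun t ht => hb u t (le_of_lt ht)
  have hR : ∀ u, R u = ∫ t in Set.Ioi (0 : ℝ), Real.exp (-l * t) • T.orbit u t := fun u => rfl
  refine ⟨R, ⟨fun u => ?_, fun w => ?_⟩, hR⟩
  · have hF : Continuous fun t : ℝ => Real.exp (-l * t) • T.orbit u t :=
      Continuous.smul (by fun_prop) (T.continuous_orbit u)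
    have hd : HasDerivAt (fun h : ℝ => Real.exp (l * h) •
        (R u - ∫ t in (0 : ℝ)..h, Real.exp (-l * t) • T.orbit u t)) (l • R u - u) 0 := by
      have h1 := ((hF.integral_hasStrictDerivAt 0 0).hasDerivAt.const_sub (R u))
      have h2 : HasDerivAt (fun h : ℝ => Real.exp (l * h)) l 0 := by
        simpa using ((hasDerivAt_id (0 : ℝ)).const_mul l).exp
      have h3 := h2.smul h1
      simp only [mul_zero, Real.exp_zero, one_smul, T.orbit_zero, intervalIntegral.integral_same,
        sub_zero] at h3
      rw [show l • R u - u = -u + l • R u by rw [sub_eq_neg_add]]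
      exact h3
    have ht := T.tendsto_diffQuot_of_hasDerivAt hd fun t => T.op_laplace hl u t
    refine ⟨⟨R u, _, ht⟩, rfl, ?_⟩
    have := tendsto_nhds_unique (T.tendsto_generator ⟨R u, _, ht⟩) ht
    rw [this]
    simp
  · rw [hR]
    -- The integrand for (l - A)w has the antiderivative -e^{-lt}T(t)w, which runs from -w at 0 to 0
    -- at infinity.
    have hd : ∀ t ∈ Set.Ioi (0 : ℝ), HasDerivAt (fun t : ℝ => -(Real.exp (-l * t) • T.orbit w t))
        (Real.exp (-l * t) • T.orbit (l • (w : X) - T.generator w) t) t := by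
      intro t ht
      have h2 : HasDerivAt (fun h : ℝ => Real.exp (-l * h)) (Real.exp (-l * t) * -l) t := by
        simpa using ((hasDerivAt_id t).const_mul (-l)).exp
      refine (h2.smul (T.hasDerivAt_orbit w ht)).neg.congr_deriv ?_
      simp only [orbit, map_sub, map_smul]
      module
    have hlim : Tendsto (fun t : ℝ => -(Real.exp (-l * t) • T.orbit w t)) atTop (𝓝 0) := by
      rw [← neg_zero]
      refine Tendsto.neg ?_
      refine squeeze_zero_norm' (a := fun t => M * Real.exp ((ω - l) * t) * ‖(w : X)‖) ?_ ?_
      · filter_upwards [eventually_ge_atTop 0] with t ht using hb w t ht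
      · have h4 : Tendsto (fun t => Real.exp ((ω - l) * t)) atTop (𝓝 0) :=
          Real.tendsto_exp_atBot.comp (tendsto_id.const_mul_atTop_of_neg (sub_neg.2 hω))
        simpa using (h4.const_mul M).mul_const ‖(w : X)‖
    have := integral_Ioi_of_hasDerivAt_of_tendsto
      (Continuous.continuousWithinAt (by
        exact (Continuous.smul (by fun_prop) (T.continuous_orbit w)).neg)) hd (hi _) hlim
    rw [this]
    simp [T.orbit_zero]

theorem mem_realResolventSet [CompleteSpace X] {l : ℝ} (hl : T.GrowthBoundLT l) :
    l ∈ realResolventSet T.generator :=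
  (T.exists_isResolventOp hl).imp fun _ h => h.1

end Banach
end C0Semigroup

/-! ### Strong convergence l(l - A)⁻¹ → I and density of the domain -/

section

variable {X : Type*} [NormedAddCommGroup X] [NormedSpace ℝ X]

theorem IsResolventOp.eq {A : X →ₗ.[ℝ] X} {l : ℝ} {R R' : X →L[ℝ] X} (h : IsResolventOp A l R)
    (h' : IsResolventOp A l R') : R = R' := by
  ext u
  obtain ⟨w, hw, hwu⟩ := h.1 u
  rw [← hw, ← h'.2 w, hwu]

theorem C0Semigroup.resolventOp_apply [CompleteSpace X] (T : C0Semigroup X) {l : ℝ}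
    (hl : T.GrowthBoundLT l) (u : X) : resolventOp T.generator l u =
      ∫ t in Set.Ioi (0 : ℝ), Real.exp (-l * t) • T.orbit u t := by
  obtain ⟨R, hR, hR'⟩ := T.exists_isResolventOp hl
  rw [(isResolventOp_resolventOp (T.mem_realResolventSet hl)).eq hR, hR']

/-- The substitution s = lt gives l(l - A)⁻¹u = ∫₀^∞ e^{-s} T(s/l)u ds, to which dominated
convergence applies. -/
theorem C0Semigroup.tendsto_smul_resolventOp [CompleteSpace X] (T : C0Semigroup X) (u : X) :
    Tendsto (fun l : ℝ => l • resolventOp T.generator l u) atTop (𝓝 u) := by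
  obtain ⟨ω, M, hM⟩ := T.exists_exp_bound
  have hM0 := GrowthBoundLT.const_nonneg hM
  have hexp : IntegrableOn (fun s : ℝ => Real.exp (-(1 / 2) * s)) (Set.Ioi 0) :=
    integrableOn_exp_mul_Ioi (by norm_num) 0
  have key : Tendsto (fun l : ℝ => ∫ s in Set.Ioi (0 : ℝ), Real.exp (-s) • T.orbit u (s / l))
      atTop (𝓝 (∫ s in Set.Ioi (0 : ℝ), Real.exp (-s) • u)) := by
    refine tendsto_integral_filter_of_dominated_convergence
      (fun s => M * ‖u‖ * Real.exp (-(1 / 2) * s)) ?_ ?_ (hexp.const_mul _) ?_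
    · refine Eventually.of_forall fun l => Continuous.aestronglyMeasurable ?_
      exact Continuous.smul (by fun_prop) ((T.continuous_orbit u).comp (by fun_prop))
    -- For l ≥ 2|ω| the growth e^{ωs/l} is at most e^{s/2}, so half of the decay of e^{-s} remains.
    · filter_upwards [eventually_ge_atTop (2 * |ω|), eventually_gt_atTop 0] with l hl hl0
      refine (ae_restrict_mem measurableSet_Ioi).mono fun s hs => ?_
      have hs : 0 < s := hs
      have h1 := (T.op (s / l).toNNReal).le_of_opNorm_le (hM _) u
      rw [Real.coe_toNNReal _ (by positivity)] at h1
      have h2 : ω * (s / l) ≤ 1 / 2 * s := by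
        rw [mul_div_assoc', div_le_iff₀ hl0]
        nlinarith [le_abs_self ω]
      rw [norm_smul, Real.norm_of_nonneg (Real.exp_pos _).le]
      calc _ ≤ Real.exp (-s) * (M * Real.exp (1 / 2 * s) * ‖u‖) := by
            gcongr
            refine h1.trans ?_
            gcongr
        _ = M * ‖u‖ * Real.exp (-(1 / 2) * s) := by
          rw [show -(1 / 2) * s = -s + 1 / 2 * s by ring, Real.exp_add]; ring
    · refine Eventually.of_forall fun s => Tendsto.const_smul ?_ _
      have h1 : Tendsto (fun l : ℝ => s / l) atTop (𝓝 0) := tendsto_const_nhds.div_atTop tendsto_id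
      simpa [T.orbit_zero, Function.comp_def] using ((T.continuous_orbit u).tendsto 0).comp h1
  rw [integral_smul_const, integral_exp_neg_Ioi_zero, one_smul] at key
  refine key.congr' ?_
  filter_upwards [T.eventually_growthBoundLT, eventually_gt_atTop 0] with l hl hl0
  have h1 := integral_comp_mul_left_Ioi (fun s => Real.exp (-s) • T.orbit u (s / l)) 0 hl0
  rw [mul_zero] at h1
  have h2 : ∀ t : ℝ, Real.exp (-l * t) • T.orbit u t =
      Real.exp (-(l * t)) • T.orbit u (l * t / l) := by
    intro t
    rw [mul_div_cancel_left₀ _ hl0.ne', neg_mul]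
  simp only [T.resolventOp_apply hl, h2]
  rw [h1, smul_smul, mul_inv_cancel₀ hl0.ne', one_smul]

theorem C0Semigroup.dense_domain [CompleteSpace X] (T : C0Semigroup X) :
    Dense (T.generator.domain : Set X) := by
  intro u
  refine mem_closure_of_tendsto (T.tendsto_smul_resolventOp u) ?_
  filter_upwards [T.eventually_growthBoundLT] with l hl
  obtain ⟨w, hw, -⟩ := (isResolventOp_resolventOp (T.mem_realResolventSet hl)).1 u
  rw [← hw]
  exact T.generator.domain.smul_mem l w.2

end

/-! ### Order and the L₁ norm, tested by inner products in L₂ -/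

section L2Order

variable {Ω : Type*} [MeasurableSpace Ω] {m : Measure Ω}

instance Lp.instIsOrderedModuleReal {p : ℝ≥0∞} [Fact (1 ≤ p)] : IsOrderedModule ℝ (Lp ℝ p m) :=
  .of_smul_nonneg fun c hc f hf => by
    rw [← Lp.coeFn_nonneg] at hf ⊢
    filter_upwards [hf, Lp.coeFn_smul c f] with x hx hcx
    rw [hcx]
    exact mul_nonneg hc hx

theorem normL1_nonneg (u : Lp ℝ 2 m) : 0 ≤ normL1 u := ENNReal.toReal_nonneg

theorem normL1_eq_integral {u : Lp ℝ 2 m} (hu : 0 ≤ u) : normL1 u = ∫ x, u x ∂m := by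
  rw [normL1, eLpNorm_one_eq_lintegral_enorm, integral_eq_lintegral_of_nonneg_ae
    ((Lp.coeFn_nonneg u).2 hu) (Lp.aestronglyMeasurable u)]
  congr 1
  refine lintegral_congr_ae ?_
  filter_upwards [(Lp.coeFn_nonneg u).2 hu] with x hx
  exact Real.enorm_of_nonneg hx

theorem inner_eq_integral_mul (f g : Lp ℝ 2 m) : inner ℝ f g = ∫ x, g x * f x ∂m := rfl

theorem integrable_mul_Lp_two (f g : Lp ℝ 2 m) : Integrable (fun x => g x * f x) m :=
  L2.integrable_inner f g

theorem inner_le_of_ae_le_add {f g v : Lp ℝ 2 m} {c : ℝ} (h : ∀ᵐ x ∂m, f x ≤ g x + c)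
    (hv : 0 ≤ v) (hv1 : MemLp v 1 m) : inner ℝ f v ≤ inner ℝ g v + c * normL1 v := by
  have hv' : Integrable v m := memLp_one_iff_integrable.1 hv1
  rw [inner_eq_integral_mul, inner_eq_integral_mul, normL1_eq_integral hv, ← integral_const_mul,
    ← integral_add (integrable_mul_Lp_two g v) (hv'.const_mul c)]
  refine integral_mono_ae (integrable_mul_Lp_two f v)
    ((integrable_mul_Lp_two g v).add (hv'.const_mul c)) ?_
  filter_upwards [h, (Lp.coeFn_nonneg v).2 hv] with x hx hvx
  have : (0 : ℝ) ≤ v x := hvx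
  nlinarith

theorem inner_nonneg_of_nonneg {f g : Lp ℝ 2 m} (hf : 0 ≤ f) (hg : 0 ≤ g) :
    0 ≤ inner ℝ f g := by
  rw [inner_eq_integral_mul]
  refine integral_nonneg_of_ae ?_
  filter_upwards [(Lp.coeFn_nonneg f).2 hf, (Lp.coeFn_nonneg g).2 hg] with x h1 h2
  exact mul_nonneg h2 h1

theorem indicatorConstLp_one_nonneg {E : Set Ω} (hE : MeasurableSet E) (hmE : m E ≠ ∞) :
    0 ≤ indicatorConstLp 2 hE hmE (1 : ℝ) := by
  rw [← Lp.coeFn_nonneg]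
  filter_upwards [indicatorConstLp_coeFn (p := 2) (hs := hE) (hμs := hmE) (c := (1 : ℝ))] with x hx
  rw [hx]
  exact Set.indicator_nonneg (fun _ _ => zero_le_one) x

theorem indicatorConstLp_one_le_one {E : Set Ω} (hE : MeasurableSet E) (hmE : m E ≠ ∞) :
    ∀ᵐ x ∂m, indicatorConstLp 2 hE hmE (1 : ℝ) x ≤ 1 := by
  filter_upwards [indicatorConstLp_coeFn (p := 2) (hs := hE) (hμs := hmE) (c := (1 : ℝ))] with x hx
  rw [hx]
  exact Set.indicator_le' (fun _ _ => le_rfl) (fun _ _ => zero_le_one) x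

theorem memLp_one_indicatorConstLp {E : Set Ω} (hE : MeasurableSet E) (hmE : m E ≠ ∞) :
    MemLp (indicatorConstLp 2 hE hmE (1 : ℝ)) 1 m :=
  (memLp_indicator_const 1 hE (1 : ℝ) (Or.inr hmE)).ae_eq indicatorConstLp_coeFn.symm

theorem normL1_indicatorConstLp {E : Set Ω} (hE : MeasurableSet E) (hmE : m E ≠ ∞) :
    normL1 (indicatorConstLp 2 hE hmE (1 : ℝ)) = m.real E := by
  rw [normL1, eLpNorm_congr_ae indicatorConstLp_coeFn,
    eLpNorm_indicator_const hE one_ne_zero ENNReal.one_ne_top]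
  simp [Measure.real]

theorem measure_lt_Lp_two_lt_top (f : Lp ℝ 2 m) {ε : ℝ} (hε : 0 < ε) : m {x | ε < f x} < ∞ := by
  refine (measure_mono ?_).trans_lt
    ((Lp.memLp f).meas_ge_lt_top two_ne_zero ENNReal.ofNat_ne_top (Real.toNNReal_pos.2 hε).ne')
  intro x hx
  have hx : ε < f x := hx
  rw [Set.mem_ofPred_eq, ← NNReal.coe_le_coe, Real.coe_toNNReal _ hε.le, coe_nnnorm, Real.norm_eq_abs]
  exact hx.le.trans (le_abs_self _)

theorem measurableSet_lt_Lp_two (f : Lp ℝ 2 m) (ε : ℝ) : MeasurableSet {x | ε < f x} :=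
  measurableSet_lt measurable_const (Lp.stronglyMeasurable f).measurable

/-- The test functions are indicators of {f - g > c + 1/(n+1)}. As c ≥ 0 and f - g ∈ L₂, these sets
have finite measure, and the hypothesis forces that measure to be 0. -/
theorem ae_le_add_of_inner_le {f g : Lp ℝ 2 m} {c : ℝ} (hc : 0 ≤ c)
    (h : ∀ v : Lp ℝ 2 m, 0 ≤ v → MemLp v 1 m → inner ℝ f v ≤ inner ℝ g v + c * normL1 v) :
    ∀ᵐ x ∂m, f x ≤ g x + c := by
  have key : ∀ n : ℕ, m {x | c + 1 / ((n : ℝ) + 1) < (f - g) x} = 0 := by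
    intro n
    have hn : (0 : ℝ) < 1 / ((n : ℝ) + 1) := Nat.one_div_pos_of_nat
    have hE := measurableSet_lt_Lp_two (f - g) (c + 1 / ((n : ℝ) + 1))
    have hmE := (measure_lt_Lp_two_lt_top (f - g) (add_pos_of_nonneg_of_pos hc hn)).ne
    have h1 := h _ (indicatorConstLp_one_nonneg hE hmE) (memLp_one_indicatorConstLp hE hmE)
    rw [normL1_indicatorConstLp, ← sub_le_iff_le_add', ← inner_sub_left, real_inner_comm,
      L2.inner_indicatorConstLp_one] at h1
    have h2 := setIntegral_ge_of_const_le_real hE hmE (fun x hx => le_of_lt hx)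
      (integrableOn_Lp_of_measure_ne_top (f - g) (by norm_num) hmE)
    have h3 : m.real {x | c + 1 / ((n : ℝ) + 1) < (f - g) x} ≤ 0 := by
      by_contra! h3
      nlinarith [mul_pos hn h3]
    exact (measureReal_eq_zero_iff hmE).1 (h3.antisymm measureReal_nonneg)
  have key' : ∀ᵐ x ∂m, ∀ n : ℕ, (f - g) x ≤ c + 1 / ((n : ℝ) + 1) := by
    rw [ae_all_iff]
    intro n
    rw [ae_iff]
    simpa only [not_le] using key n
  filter_upwards [key', Lp.coeFn_sub f g] with x hx hsub
  have h1 : (f - g) x ≤ c := by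
    have := tendsto_one_div_add_atTop_nhds_zero_nat (𝕜 := ℝ)
    exact ge_of_tendsto' (by simpa using this.const_add c) hx
  rw [hsub, Pi.sub_apply] at h1
  linarith

theorem nonneg_of_forall_inner_nonneg {f : Lp ℝ 2 m}
    (h : ∀ v : Lp ℝ 2 m, 0 ≤ v → 0 ≤ inner ℝ f v) : 0 ≤ f := by
  rw [← Lp.coeFn_nonneg]
  have h1 := ae_le_add_of_inner_le (f := 0) (g := f) le_rfl fun v hv _ => by
    simpa using h v hv
  filter_upwards [h1, Lp.coeFn_zero ℝ 2 m] with x hx h0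
  rw [h0, Pi.zero_apply, add_zero] at hx
  exact hx

/-- The finite-measure sets {w > 1/(n+1)} exhaust {w > 0}; their indicators are admissible tests,
and monotone convergence concludes. Membership in L₁ is thereby a conclusion, not an assumption. -/
theorem eLpNorm_one_le_of_inner_le {w : Lp ℝ 2 m} (hw : 0 ≤ w) {a : ℝ}
    (h : ∀ v : Lp ℝ 2 m, 0 ≤ v → (∀ᵐ x ∂m, v x ≤ 1) → inner ℝ w v ≤ a) :
    eLpNorm w 1 m ≤ ENNReal.ofReal a := by
  set E : ℕ → Set Ω := fun n => {x | 1 / ((n : ℝ) + 1) < w x} with hE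
  have hEm : ∀ n, MeasurableSet (E n) := fun n => measurableSet_lt_Lp_two w _
  have hEf : ∀ n, m (E n) ≠ ∞ := fun n =>
    (measure_lt_Lp_two_lt_top w Nat.one_div_pos_of_nat).ne
  have hw0 := (Lp.coeFn_nonneg w).2 hw
  have hmeas : Measurable fun x => ENNReal.ofReal (w x) :=
    (Lp.stronglyMeasurable w).measurable.ennreal_ofReal
  have h1 : ∀ n, ∫⁻ x, (E n).indicator (fun x => ENNReal.ofReal (w x)) x ∂m ≤ ENNReal.ofReal a := by
    intro n
    rw [lintegral_indicator (hEm n), ← ofReal_integral_eq_lintegral_ofReal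
      (integrableOn_Lp_of_measure_ne_top w (by norm_num) (hEf n)) (ae_restrict_of_ae hw0),
      ← L2.inner_indicatorConstLp_one (hEm n) (hEf n), real_inner_comm]
    exact ENNReal.ofReal_le_ofReal
      (h _ (indicatorConstLp_one_nonneg _ _) (indicatorConstLp_one_le_one _ _))
  have hmono : Monotone fun n => (E n).indicator (fun x => ENNReal.ofReal (w x)) := by
    intro n k hnk
    refine Set.indicator_le_indicator_of_subset (fun x hx => ?_) (fun _ => zero_le)
    have hx : 1 / ((n : ℝ) + 1) < w x := hx
    exact (Nat.one_div_le_one_div hnk).trans_lt hx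
  have h2 := lintegral_iSup (μ := m) (fun n => hmeas.indicator (hEm n)) hmono
  calc eLpNorm w 1 m = ∫⁻ x, ENNReal.ofReal (w x) ∂m := by
        rw [eLpNorm_one_eq_lintegral_enorm]
        refine lintegral_congr_ae ?_
        filter_upwards [hw0] with x hx
        exact Real.enorm_of_nonneg hx
    _ ≤ ∫⁻ x, ⨆ n, (E n).indicator (fun x => ENNReal.ofReal (w x)) x ∂m := by
        refine lintegral_mono fun x => ?_
        rcases le_or_gt (w x) 0 with hx | hx
        · simp [ENNReal.ofReal_of_nonpos hx]
        · obtain ⟨n, hn⟩ := exists_nat_one_div_lt hx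
          refine le_iSup_of_le n ?_
          rw [Set.indicator_of_mem (by exact hn)]
    _ ≤ ENNReal.ofReal a := by
        rw [h2]
        exact iSup_le h1

theorem memLp_one_and_normL1_le {w : Lp ℝ 2 m} (hw : 0 ≤ w) {a : ℝ} (ha : 0 ≤ a)
    (h : ∀ v : Lp ℝ 2 m, 0 ≤ v → (∀ᵐ x ∂m, v x ≤ 1) → inner ℝ w v ≤ a) :
    MemLp w 1 m ∧ normL1 w ≤ a := by
  have h1 := eLpNorm_one_le_of_inner_le hw h
  exact ⟨⟨Lp.aestronglyMeasurable w, h1.trans_lt ENNReal.ofReal_lt_top⟩,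
    ENNReal.toReal_le_of_le_ofReal ha h1⟩

theorem inner_le_normL1 {f v : Lp ℝ 2 m} (hf : ∀ᵐ x ∂m, f x ≤ 1) (hv : 0 ≤ v)
    (hv1 : MemLp v 1 m) : inner ℝ v f ≤ normL1 v := by
  have := inner_le_of_ae_le_add (f := f) (g := 0) (c := 1) (v := v) (by
    filter_upwards [hf, Lp.coeFn_zero ℝ 2 m] with x hx h0
    rw [h0, Pi.zero_apply, zero_add]
    exact hx) hv hv1
  simpa [real_inner_comm] using this

theorem IsL1Contraction.memLp {B : Lp ℝ 2 m →L[ℝ] Lp ℝ 2 m} (hB : IsL1Contraction B)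
    {u : Lp ℝ 2 m} (hu : MemLp u 1 m) : MemLp (B u) 1 m :=
  ⟨Lp.aestronglyMeasurable _, (hB u hu).trans_lt hu.2⟩

theorem IsL1Contraction.normL1_le {B : Lp ℝ 2 m →L[ℝ] Lp ℝ 2 m} (hB : IsL1Contraction B)
    {u : Lp ℝ 2 m} (hu : MemLp u 1 m) : normL1 (B u) ≤ normL1 u :=
  ENNReal.toReal_mono hu.2.ne (hB u hu)

theorem adjoint_nonneg {B : Lp ℝ 2 m →L[ℝ] Lp ℝ 2 m} (hB : ∀ u, 0 ≤ u → 0 ≤ B u)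
    {v : Lp ℝ 2 m} (hv : 0 ≤ v) : 0 ≤ ContinuousLinearMap.adjoint B v :=
  nonneg_of_forall_inner_nonneg fun w hw => by
    rw [ContinuousLinearMap.adjoint_inner_left]
    exact inner_nonneg_of_nonneg hv (hB w hw)

end L2Order

/-! ### L₁ bounds for resolvents and their adjoints -/

namespace C0Semigroup

section L2

variable {Ω : Type*} [MeasurableSpace Ω] {m : Measure Ω} {T : C0Semigroup (Lp ℝ 2 m)} {l : ℝ}

theorem IsPositive.laplace_integrand_nonneg (hT : T.IsPositive) {u : Lp ℝ 2 m} (hu : 0 ≤ u)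
    (t : ℝ) : 0 ≤ Real.exp (-l * t) • T.orbit u t :=
  smul_nonneg (Real.exp_pos _).le (hT _ u hu)

theorem IsPositive.resolventOp_nonneg (hT : T.IsPositive) (hl : T.GrowthBoundLT l)
    {u : Lp ℝ 2 m} (hu : 0 ≤ u) : 0 ≤ resolventOp T.generator l u := by
  rw [T.resolventOp_apply hl]
  exact integral_nonneg_of_ae (.of_forall (hT.laplace_integrand_nonneg hu))

/-- The weight e^{-lt} has total mass 1/l on (0,∞). -/
theorem inner_resolventOp_le (hl : T.GrowthBoundLT l) (hl0 : 0 < l) {u v : Lp ℝ 2 m} {a : ℝ}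
    (h : ∀ t, inner ℝ (T.op t u) v ≤ a) : inner ℝ (resolventOp T.generator l u) v ≤ a / l := by
  have hi := T.integrableOn_laplace hl u
  have he : IntegrableOn (fun t : ℝ => Real.exp (-l * t)) (Set.Ioi 0) :=
    integrableOn_exp_mul_Ioi (neg_lt_zero.2 hl0) 0
  rw [T.resolventOp_apply hl, real_inner_comm, ← integral_inner hi]
  calc _ ≤ ∫ t in Set.Ioi (0 : ℝ), Real.exp (-l * t) * a := by
        refine integral_mono (hi.const_inner v) (he.mul_const a) fun t => ?_
        simp only
        rw [real_inner_smul_right, real_inner_comm]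
        exact mul_le_mul_of_nonneg_left (h _) (Real.exp_pos _).le
    _ = a / l := by
        rw [integral_mul_const, integral_exp_mul_Ioi (neg_lt_zero.2 hl0)]
        simp only [mul_zero, Real.exp_zero]
        field_simp

theorem IsPositive.normL1_resolventOp_le (hT : T.IsPositive)
    (hc : ∀ t, IsL1Contraction (T.op t)) (hl : T.GrowthBoundLT l) (hl0 : 0 < l)
    {u : Lp ℝ 2 m} (hu : 0 ≤ u) (hu1 : MemLp u 1 m) :
    MemLp (resolventOp T.generator l u) 1 m ∧
      normL1 (resolventOp T.generator l u) ≤ normL1 u / l :=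
  memLp_one_and_normL1_le (hT.resolventOp_nonneg hl hu)
    (div_nonneg (normL1_nonneg u) hl0.le) fun _ _ hv1 =>
      inner_resolventOp_le hl hl0 fun t =>
        (inner_le_normL1 hv1 (hT t u hu) ((hc t).memLp hu1)).trans ((hc t).normL1_le hu1)

/-- Tested against 0 ≤ v ≤ 1, the adjoint moves onto each T(t) under the Laplace integral, so no
semigroup theory for T(t)* is needed. -/
theorem IsPositive.normL1_adjoint_resolventOp_le (hT : T.IsPositive)
    (hc : ∀ t, IsL1Contraction (ContinuousLinearMap.adjoint (T.op t)))
    (hl : T.GrowthBoundLT l) (hl0 : 0 < l) {u : Lp ℝ 2 m} (hu : 0 ≤ u) (hu1 : MemLp u 1 m) :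
    MemLp (ContinuousLinearMap.adjoint (resolventOp T.generator l) u) 1 m ∧
      normL1 (ContinuousLinearMap.adjoint (resolventOp T.generator l) u) ≤ normL1 u / l := by
  refine memLp_one_and_normL1_le (adjoint_nonneg (fun _ => hT.resolventOp_nonneg hl) hu)
    (div_nonneg (normL1_nonneg u) hl0.le) fun v _ hv1 => ?_
  rw [ContinuousLinearMap.adjoint_inner_left, real_inner_comm]
  refine inner_resolventOp_le hl hl0 fun t => ?_
  rw [real_inner_comm, ← ContinuousLinearMap.adjoint_inner_left]
  exact (inner_le_normL1 hv1 (adjoint_nonneg (hT t) hu) ((hc t).memLp hu1)).trans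
    ((hc t).normL1_le hu1)

end L2

end C0Semigroup

/-! ### A product rule for T(t-r)y(r), and truncated Laplace transforms -/

namespace C0Semigroup

section Banach

variable {X : Type*} [NormedAddCommGroup X] [NormedSpace ℝ X] [CompleteSpace X]
  (T : C0Semigroup X)

theorem tendsto_op_apply {ι : Type*} {f : Filter ι} {a : ι → ℝ≥0} {y : ι → X} {t : ℝ≥0} {x : X}
    (ha : Tendsto a f (𝓝 t)) (hy : Tendsto y f (𝓝 x)) :
    Tendsto (fun i => T.op (a i) (y i)) f (𝓝 (T.op t x)) := by
  obtain ⟨B, hB⟩ := T.exists_bound (t + 1)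
  refine tendsto_clm_apply_of_bounded (B := B) ?_ (((T.continuous_op x).tendsto t).comp ha) hy
  filter_upwards [ha.eventually_lt_const (lt_add_one t)] with i hi
  exact hB _ hi.le

theorem continuous_op_apply : Continuous fun p : ℝ≥0 × X => T.op p.1 p.2 :=
  continuous_iff_continuousAt.2 fun _ => T.tendsto_op_apply continuousAt_fst continuousAt_snd

/-- Split y(r) = (y(r) - y(s)) + y(s): joint continuity handles the first part, and
differentiability of the orbit of y(s) ∈ D(A) the second. -/
theorem hasDerivAt_op_sub_apply {t s : ℝ} (hs : s < t) {y : ℝ → X} {y' : X}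
    (hy : HasDerivAt y y' s) (w : T.generator.domain) (hw : (w : X) = y s) :
    HasDerivAt (fun r => T.op (t - r).toNNReal (y r))
      (T.op (t - s).toNNReal y' - T.op (t - s).toNNReal (T.generator w)) s := by
  have h1 : HasDerivAt (fun r => T.op (t - r).toNNReal (y r - y s))
      (T.op (t - s).toNNReal y') s := by
    rw [hasDerivAt_iff_tendsto_slope]
    have hc : Tendsto (fun r => (t - r).toNNReal) (𝓝[≠] s) (𝓝 (t - s).toNNReal) :=
      (Continuous.tendsto (by fun_prop) s).mono_left nhdsWithin_le_nhds
    refine (T.tendsto_op_apply hc (hasDerivAt_iff_tendsto_slope.1 hy)).congr fun r => ?_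
    simp [slope_def_module]
  have h2 : HasDerivAt (fun r => T.op (t - r).toNNReal (y s))
      (-T.op (t - s).toNNReal (T.generator w)) s := by
    have := (T.hasDerivAt_orbit w (sub_pos.2 hs)).scomp s ((hasDerivAt_id s).const_sub t)
    simp only [neg_smul, one_smul, hw] at this
    exact this
  have h3 := h1.add h2
  rw [← sub_eq_add_neg] at h3
  refine h3.congr_of_eventuallyEq (.of_forall fun r => ?_)
  simp

end Banach

section L2

variable {Ω : Type*} [MeasurableSpace Ω] {m : Measure Ω} {T T₀ : C0Semigroup (Lp ℝ 2 m)}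

/-- The truncated Laplace transform `∫₀ⁿ e^{-l t} T(t) u dt`. -/
noncomputable def laplaceTrunc (T : C0Semigroup (Lp ℝ 2 m)) (l : ℝ) (u : Lp ℝ 2 m) (n : ℕ) :
    Lp ℝ 2 m :=
  ∫ t in (0 : ℝ)..n, Real.exp (-l * t) • T.orbit u t

theorem laplaceLimit_eq_iSup (T : C0Semigroup (Lp ℝ 2 m)) (l : ℝ) (u : Lp ℝ 2 m) (x : Ω) :
    T.laplaceLimit l u x = ⨆ n : ℕ, ENNReal.ofReal (T.laplaceTrunc l u n x) := rfl

theorem continuous_laplace_integrand (T : C0Semigroup (Lp ℝ 2 m)) (l : ℝ) (u : Lp ℝ 2 m) :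
    Continuous fun t : ℝ => Real.exp (-l * t) • T.orbit u t :=
  (show Continuous fun t : ℝ => Real.exp (-l * t) by fun_prop).smul (T.continuous_orbit u)

theorem inner_laplaceTrunc (T : C0Semigroup (Lp ℝ 2 m)) (l : ℝ) (u v : Lp ℝ 2 m) (n : ℕ) :
    inner ℝ (T.laplaceTrunc l u n) v =
      ∫ t in (0 : ℝ)..n, Real.exp (-l * t) * inner ℝ (T.orbit u t) v := by
  have := (innerSL ℝ v).intervalIntegral_comp_comm
    ((T.continuous_laplace_integrand l u).intervalIntegrable (μ := volume) 0 n)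
  simp only [innerSL_apply_apply, real_inner_smul_right] at this
  rw [real_inner_comm, laplaceTrunc, ← this]
  simp only [real_inner_comm]

theorem IsPositive.monotone_laplaceTrunc (hT : T.IsPositive) (l : ℝ) {u : Lp ℝ 2 m}
    (hu : 0 ≤ u) : Monotone (T.laplaceTrunc l u) := by
  intro n k hnk
  have hi := fun a b : ℝ =>
    (T.continuous_laplace_integrand l u).intervalIntegrable (μ := volume) a b
  rw [← sub_nonneg, laplaceTrunc, laplaceTrunc,
    intervalIntegral.integral_interval_sub_left (hi _ _) (hi _ _),
    intervalIntegral.integral_of_le (Nat.cast_le.2 hnk)]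
  exact integral_nonneg_of_ae (.of_forall (hT.laplace_integrand_nonneg hu))

theorem tendsto_laplaceTrunc {l : ℝ} (hl : T.GrowthBoundLT l) (u : Lp ℝ 2 m) :
    Tendsto (T.laplaceTrunc l u) atTop (𝓝 (resolventOp T.generator l u)) := by
  rw [T.resolventOp_apply hl]
  exact intervalIntegral_tendsto_integral_Ioi 0 (T.integrableOn_laplace hl u)
    tendsto_natCast_atTop_atTop

theorem IsPositive.laplaceLimit_ae_eq (hT : T.IsPositive) {l : ℝ} (hl : T.GrowthBoundLT l)
    {u : Lp ℝ 2 m} (hu : 0 ≤ u) :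
    ∀ᵐ x ∂m, T.laplaceLimit l u x = ENNReal.ofReal (resolventOp T.generator l u x) := by
  have hlim := tendsto_laplaceTrunc hl u
  have hle : ∀ᵐ x ∂m, ∀ n, T.laplaceTrunc l u n x ≤ resolventOp T.generator l u x :=
    ae_all_iff.2 fun n =>
      (Lp.coeFn_le _ _).2 ((hT.monotone_laplaceTrunc l hu).ge_of_tendsto hlim n)
  -- Convergence a.e. along a subsequence suffices, since the supremum dominates every term.
  obtain ⟨φ, -, hφ⟩ := (tendstoInMeasure_of_tendsto_Lp hlim).exists_seq_tendsto_ae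
  filter_upwards [hle, hφ] with x hx hφx
  rw [laplaceLimit_eq_iSup]
  refine le_antisymm (iSup_le fun n => ENNReal.ofReal_le_ofReal (hx n)) ?_
  exact le_of_tendsto' (ENNReal.tendsto_ofReal hφx) fun k =>
    le_iSup (fun n => ENNReal.ofReal (T.laplaceTrunc l u n x)) (φ k)

end L2

end C0Semigroup

theorem intervalIntegral_exp_mul_self_le {l : ℝ} (hl : 0 < l) {b : ℝ} (hb : 0 ≤ b) :
    ∫ t in (0 : ℝ)..b, Real.exp (-l * t) * t ≤ 1 / l ^ 2 := by
  have hd : ∀ t ∈ Set.uIcc 0 b, HasDerivAt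
      (fun t : ℝ => -((t / l + 1 / l ^ 2) * Real.exp (-l * t))) (Real.exp (-l * t) * t) t := by
    intro t _
    have h1 : HasDerivAt (fun t : ℝ => Real.exp (-l * t)) (Real.exp (-l * t) * -l) t := by
      simpa using ((hasDerivAt_id t).const_mul (-l)).exp
    have h2 : HasDerivAt (fun t : ℝ => t / l + 1 / l ^ 2) (1 / l) t :=
      ((hasDerivAt_id t).div_const l).add_const _
    refine (h2.mul h1).neg.congr_deriv ?_
    field_simp
    ring
  rw [intervalIntegral.integral_eq_sub_of_hasDerivAt hd
    ((Continuous.mul (by fun_prop) continuous_id).intervalIntegrable _ _)]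
  -- The boundary term at b has a favourable sign and is dropped.
  have : 0 ≤ (b / l + 1 / l ^ 2) * Real.exp (-l * b) := by positivity
  simp only [zero_div, zero_add, mul_zero, Real.exp_zero, mul_one]
  linarith

/-! ### The implications between the estimates -/

namespace C0Semigroup

section Comparison

variable {Ω : Type*} [MeasurableSpace Ω] {m : Measure Ω} {T T₀ : C0Semigroup (Lp ℝ 2 m)} {C : ℝ}

theorem laplaceLimit_le_of_op_le (hC : 0 ≤ C)
    (h : ∀ (t : ℝ≥0) (u : Lp ℝ 2 m), 0 ≤ u → MemLp u 1 m →
      ∀ᵐ x ∂m, T.op t u x ≤ T₀.op t u x + C * t * normL1 u)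
    {l : ℝ} (hl : 0 < l) {u : Lp ℝ 2 m} (hu : 0 ≤ u) (hu1 : MemLp u 1 m) :
    ∀ᵐ x ∂m, T.laplaceLimit l u x ≤
      T₀.laplaceLimit l u x + ENNReal.ofReal (C / l ^ 2 * normL1 u) := by
  have hc0 : 0 ≤ C / l ^ 2 * normL1 u := mul_nonneg (by positivity) (normL1_nonneg u)
  have key : ∀ᵐ x ∂m, ∀ n,
      T.laplaceTrunc l u n x ≤ T₀.laplaceTrunc l u n x + C / l ^ 2 * normL1 u := by
    refine ae_all_iff.2 fun n => ae_le_add_of_inner_le hc0 fun v hv hv1 => ?_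
    have hcT : ∀ S : C0Semigroup (Lp ℝ 2 m),
        Continuous fun t : ℝ => Real.exp (-l * t) * inner ℝ (S.orbit u t) v := fun S =>
      Continuous.mul (by fun_prop) ((S.continuous_orbit u).inner continuous_const)
    have hce : Continuous fun t : ℝ => Real.exp (-l * t) * t := by fun_prop
    have hn : (0 : ℝ) ≤ n := n.cast_nonneg
    have hK : 0 ≤ C * normL1 u * normL1 v :=
      mul_nonneg (mul_nonneg hC (normL1_nonneg u)) (normL1_nonneg v)
    rw [inner_laplaceTrunc, inner_laplaceTrunc]
    calc ∫ t in (0 : ℝ)..n, Real.exp (-l * t) * inner ℝ (T.orbit u t) v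
        ≤ ∫ t in (0 : ℝ)..n, (Real.exp (-l * t) * inner ℝ (T₀.orbit u t) v +
            (C * normL1 u * normL1 v) * (Real.exp (-l * t) * t)) := by
          refine intervalIntegral.integral_mono_on hn ((hcT T).intervalIntegrable _ _)
            (((hcT T₀).add (hce.const_mul _)).intervalIntegrable _ _) fun t ht => ?_
          have h1 := inner_le_of_ae_le_add (h t.toNNReal u hu hu1) hv hv1
          rw [Real.coe_toNNReal _ ht.1] at h1
          have h2 := mul_le_mul_of_nonneg_left h1 (Real.exp_pos (-l * t)).le
          refine h2.trans_eq ?_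
          simp only [orbit]
          ring
      _ ≤ _ := by
          rw [intervalIntegral.integral_add ((hcT T₀).intervalIntegrable _ _)
            ((hce.const_mul _).intervalIntegrable _ _), intervalIntegral.integral_const_mul]
          have h3 := mul_le_mul_of_nonneg_left (intervalIntegral_exp_mul_self_le hl hn) hK
          have h4 : C * normL1 u * normL1 v * (1 / l ^ 2) = C / l ^ 2 * normL1 u * normL1 v := by
            ring
          linarith
  filter_upwards [key] with x hx
  rw [laplaceLimit_eq_iSup, laplaceLimit_eq_iSup]
  refine iSup_le fun n => (ENNReal.ofReal_le_ofReal (hx n)).trans ?_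
  refine ENNReal.ofReal_add_le.trans ?_
  gcongr
  exact le_iSup (fun n => ENNReal.ofReal (T₀.laplaceTrunc l u n x)) n

theorem resolventOp_le_of_laplaceLimit_le (hC : 0 ≤ C) (hT₀ : T₀.IsPositive) (hT : T.IsPositive)
    {l : ℝ} (hl : T.GrowthBoundLT l) (hl₀ : T₀.GrowthBoundLT l) {u : Lp ℝ 2 m} (hu : 0 ≤ u)
    (h : ∀ᵐ x ∂m, T.laplaceLimit l u x ≤
      T₀.laplaceLimit l u x + ENNReal.ofReal (C / l ^ 2 * normL1 u)) :
    ∀ᵐ x ∂m, resolventOp T.generator l u x ≤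
      resolventOp T₀.generator l u x + C / l ^ 2 * normL1 u := by
  have hc0 : 0 ≤ C / l ^ 2 * normL1 u := mul_nonneg (by positivity) (normL1_nonneg u)
  filter_upwards [h, hT.laplaceLimit_ae_eq hl hu, hT₀.laplaceLimit_ae_eq hl₀ hu,
    (Lp.coeFn_nonneg _).2 (hT₀.resolventOp_nonneg hl₀ hu)] with x hx h1 h2 h3
  have h3 : 0 ≤ resolventOp T₀.generator l u x := h3
  rw [h1, h2, ← ENNReal.ofReal_add h3 hc0] at hx
  exact (ENNReal.ofReal_le_ofReal_iff (add_nonneg h3 hc0)).1 hx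

/-- With R and R₀ the resolvents of A and A₀, lRAu = l²Ru - lu and l⟨R₀u, A₀*v⟩ = l²⟨R₀u, v⟩ - l⟨u,
v⟩. The difference after pairing the first with v is l²⟨(R - R₀)u, v⟩ ≤ C‖u‖₁‖v‖₁, and l → ∞ gives
the claim. -/
theorem inner_generator_le_of_resolventOp_le
    (h : ∀ l : ℝ, 0 < l → T.GrowthBoundLT l → T₀.GrowthBoundLT l →
      ∀ u : Lp ℝ 2 m, 0 ≤ u → MemLp u 1 m → ∀ᵐ x ∂m, resolventOp T.generator l u x ≤
        resolventOp T₀.generator l u x + C / l ^ 2 * normL1 u)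
    (u : T.generator.domain) (v : T₀.generator.adjoint.domain) (hu : 0 ≤ (u : Lp ℝ 2 m))
    (hu1 : MemLp (u : Lp ℝ 2 m) 1 m) (hv : 0 ≤ (v : Lp ℝ 2 m))
    (hv1 : MemLp (v : Lp ℝ 2 m) 1 m) :
    inner ℝ (T.generator u) (v : Lp ℝ 2 m) ≤
      inner ℝ (u : Lp ℝ 2 m) (T₀.generator.adjoint v) +
        C * normL1 (u : Lp ℝ 2 m) * normL1 (v : Lp ℝ 2 m) := by
  have h1 := (T.tendsto_smul_resolventOp (T.generator u)).inner (𝕜 := ℝ)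
    (tendsto_const_nhds (x := (v : Lp ℝ 2 m)))
  have h2 := ((T₀.tendsto_smul_resolventOp (u : Lp ℝ 2 m)).inner (𝕜 := ℝ)
    (tendsto_const_nhds (x := T₀.generator.adjoint v))).add_const
      (C * normL1 (u : Lp ℝ 2 m) * normL1 (v : Lp ℝ 2 m))
  refine le_of_tendsto_of_tendsto h1 h2 ?_
  filter_upwards [eventually_gt_atTop 0, T.eventually_growthBoundLT,
    T₀.eventually_growthBoundLT] with l hl hlT hlT₀
  have h3 := inner_le_of_ae_le_add (h l hl hlT hlT₀ u hu hu1) hv hv1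
  have hR := (isResolventOp_resolventOp (T.mem_realResolventSet hlT)).2 u
  rw [map_sub, map_smul, sub_eq_iff_eq_add, ← sub_eq_iff_eq_add'] at hR
  obtain ⟨w, hw, hwu⟩ := (isResolventOp_resolventOp (T₀.mem_realResolventSet hlT₀)).1 u
  rw [sub_eq_iff_eq_add, ← sub_eq_iff_eq_add'] at hwu
  have h4 := LinearPMap.adjoint_isFormalAdjoint T₀.dense_domain v w
  rw [real_inner_comm, ← hwu, hw] at h4
  rw [← hR, real_inner_smul_left, real_inner_smul_left, h4,
    real_inner_comm _ (v : Lp ℝ 2 m), inner_sub_left, inner_sub_left, real_inner_smul_left,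
    real_inner_smul_left]
  have h5 := mul_le_mul_of_nonneg_left h3 (sq_nonneg l)
  have h6 : l ^ 2 * (C / l ^ 2 * normL1 (u : Lp ℝ 2 m) * normL1 (v : Lp ℝ 2 m)) =
      C * normL1 (u : Lp ℝ 2 m) * normL1 (v : Lp ℝ 2 m) := by
    field_simp
  nlinarith

theorem adjoint_resolventOp_mem_adjoint_domain {l : ℝ} (hl : T₀.GrowthBoundLT l) (w : Lp ℝ 2 m) :
    ∃ v : T₀.generator.adjoint.domain,
      (v : Lp ℝ 2 m) = ContinuousLinearMap.adjoint (resolventOp T₀.generator l) w ∧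
      T₀.generator.adjoint v =
        l • ContinuousLinearMap.adjoint (resolventOp T₀.generator l) w - w := by
  have key : ∀ x : T₀.generator.domain,
      inner ℝ (l • ContinuousLinearMap.adjoint (resolventOp T₀.generator l) w - w) (x : Lp ℝ 2 m) =
        inner ℝ (ContinuousLinearMap.adjoint (resolventOp T₀.generator l) w)
          (T₀.generator x) := by
    intro x
    have hR := (isResolventOp_resolventOp (T₀.mem_realResolventSet hl)).2 x
    rw [map_sub, map_smul, sub_eq_iff_eq_add, ← sub_eq_iff_eq_add'] at hR
    rw [inner_sub_left, real_inner_smul_left, ContinuousLinearMap.adjoint_inner_left,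
      ContinuousLinearMap.adjoint_inner_left, ← hR, inner_sub_right, real_inner_smul_right]
  exact ⟨⟨_, LinearPMap.mem_adjoint_domain_of_exists _ ⟨_, key⟩⟩, rfl,
    LinearPMap.adjoint_apply_eq T₀.dense_domain _ key⟩

theorem inner_resolventOp_op_le (hC : 0 ≤ C) (hT₀ : T₀.IsPositive) (hT : T.IsPositive)
    (hT_contr : ∀ t : ℝ≥0, IsL1Contraction (T.op t))
    (hT₀_contr : ∀ t : ℝ≥0, IsL1Contraction (ContinuousLinearMap.adjoint (T₀.op t)))
    (h : ∀ (u : T.generator.domain) (v : T₀.generator.adjoint.domain),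
      0 ≤ (u : Lp ℝ 2 m) → MemLp (u : Lp ℝ 2 m) 1 m →
      0 ≤ (v : Lp ℝ 2 m) → MemLp (v : Lp ℝ 2 m) 1 m →
      inner ℝ (T.generator u) (v : Lp ℝ 2 m) ≤
        inner ℝ (u : Lp ℝ 2 m) (T₀.generator.adjoint v) +
          C * normL1 (u : Lp ℝ 2 m) * normL1 (v : Lp ℝ 2 m))
    {l : ℝ} (hl0 : 0 < l) (hl : T₀.GrowthBoundLT l)
    {u : T.generator.domain} {v : Lp ℝ 2 m} (hu : 0 ≤ (u : Lp ℝ 2 m))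
    (hu1 : MemLp (u : Lp ℝ 2 m) 1 m) (hv : 0 ≤ v) (hv1 : MemLp v 1 m) (t : ℝ≥0) :
    inner ℝ (resolventOp T₀.generator l (T.op t u)) v ≤
      inner ℝ (T₀.op t (resolventOp T₀.generator l u)) v +
        C * normL1 (u : Lp ℝ 2 m) * (normL1 v / l) * t := by
  set R := resolventOp T₀.generator l with hR
  -- The derivative equals ⟨Au', V⟩ - ⟨u', A₀*V⟩ with u' = T(s)u and V = R*T₀(t-s)*v, an admissible
  -- pair for the generator estimate.
  have hderiv : ∀ s ∈ Set.Ioo (0 : ℝ) t, ∃ d ≤ C * normL1 (u : Lp ℝ 2 m) * (normL1 v / l),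
      HasDerivAt (fun s : ℝ => inner ℝ (T₀.op (t - s).toNNReal (R (T.orbit u s))) v) d s := by
    intro s hs
    obtain ⟨w, hw, hwx⟩ := (isResolventOp_resolventOp (T₀.mem_realResolventSet hl)).1 (T.orbit u s)
    rw [← hR] at hw
    rw [sub_eq_iff_eq_add, ← sub_eq_iff_eq_add', hw] at hwx
    have hd := T₀.hasDerivAt_op_sub_apply hs.2
      (R.hasFDerivAt.comp_hasDerivAt s (T.hasDerivAt_orbit u hs.1)) w hw
    refine ⟨_, ?_, (hd.inner ℝ (hasDerivAt_const s v))⟩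
    set τ := ((t : ℝ) - s).toNNReal
    obtain ⟨u', hu', hAu'⟩ := T.op_mem_domain u s.toNNReal
    have hWpos := adjoint_nonneg (hT₀ τ) hv
    have hWmem := (hT₀_contr τ).memLp hv1
    obtain ⟨V, hV, hAV⟩ := adjoint_resolventOp_mem_adjoint_domain hl
      (ContinuousLinearMap.adjoint (T₀.op τ) v)
    rw [← hR] at hV hAV
    have hV1 := hT₀.normL1_adjoint_resolventOp_le hT₀_contr hl hl0 hWpos hWmem
    rw [← hR, ← hV] at hV1
    have h1 := h u' V (by rw [hu']; exact hT _ _ hu) (by rw [hu']; exact (hT_contr _).memLp hu1)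
      (by rw [hV]; exact adjoint_nonneg (fun _ => hT₀.resolventOp_nonneg hl) hWpos) hV1.1
    have h2 : C * normL1 (u' : Lp ℝ 2 m) * normL1 (V : Lp ℝ 2 m) ≤
        C * normL1 (u : Lp ℝ 2 m) * (normL1 v / l) := by
      have h3 : normL1 (u' : Lp ℝ 2 m) ≤ normL1 (u : Lp ℝ 2 m) := by
        rw [hu']; exact (hT_contr _).normL1_le hu1
      have h4 : normL1 (V : Lp ℝ 2 m) ≤ normL1 v / l := by
        refine hV1.2.trans ?_
        gcongr
        exact (hT₀_contr τ).normL1_le hv1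
      have h5 := normL1_nonneg (V : Lp ℝ 2 m)
      have h6 := normL1_nonneg (u : Lp ℝ 2 m)
      gcongr
    refine le_trans (le_of_eq ?_) ((sub_le_iff_le_add'.2 h1).trans h2)
    rw [hAV, hV, hAu', hu', ← hwx]
    simp only [inner_zero_right, zero_add, inner_sub_left, inner_sub_right, real_inner_smul_right,
      ContinuousLinearMap.adjoint_inner_right, map_sub, map_smul, real_inner_smul_left, orbit]
  have hcont : Continuous fun s : ℝ => inner ℝ (T₀.op (t - s).toNNReal (R (T.orbit u s))) v := by
    refine Continuous.inner ?_ continuous_const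
    exact T₀.continuous_op_apply.comp (Continuous.prodMk (by fun_prop)
      (R.continuous.comp (T.continuous_orbit u)))
  -- The endpoint s = t yields ⟨RT(t)u, v⟩ and s = 0 yields ⟨T₀(t)Ru, v⟩.
  have hmv := (convex_Icc (0 : ℝ) t).image_sub_le_mul_sub_of_deriv_le hcont.continuousOn
    (C := C * normL1 (u : Lp ℝ 2 m) * (normL1 v / l))
    (fun s hs => by
      rw [interior_Icc] at hs
      obtain ⟨d, -, hd⟩ := hderiv s hs
      exact hd.differentiableAt.differentiableWithinAt)
    (fun s hs => by
      rw [interior_Icc] at hs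
      obtain ⟨d, hdle, hd⟩ := hderiv s hs
      rwa [hd.deriv])
    0 (by simp) t (by simp) t.2
  simp only [sub_self, Real.toNNReal_zero, T₀.op_zero, ContinuousLinearMap.id_apply, sub_zero,
    Real.toNNReal_coe, T.orbit_coe, T.orbit_zero] at hmv
  linarith

theorem op_le_of_inner_generator_le (hC : 0 ≤ C) (hT₀ : T₀.IsPositive) (hT : T.IsPositive)
    (hT_contr : ∀ t : ℝ≥0, IsL1Contraction (T.op t))
    (hT₀_contr : ∀ t : ℝ≥0, IsL1Contraction (ContinuousLinearMap.adjoint (T₀.op t)))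
    (h : ∀ (u : T.generator.domain) (v : T₀.generator.adjoint.domain),
      0 ≤ (u : Lp ℝ 2 m) → MemLp (u : Lp ℝ 2 m) 1 m →
      0 ≤ (v : Lp ℝ 2 m) → MemLp (v : Lp ℝ 2 m) 1 m →
      inner ℝ (T.generator u) (v : Lp ℝ 2 m) ≤
        inner ℝ (u : Lp ℝ 2 m) (T₀.generator.adjoint v) +
          C * normL1 (u : Lp ℝ 2 m) * normL1 (v : Lp ℝ 2 m))
    (t : ℝ≥0) {u : Lp ℝ 2 m} (hu : 0 ≤ u) (hu1 : MemLp u 1 m) :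
    ∀ᵐ x ∂m, T.op t u x ≤ T₀.op t u x + C * t * normL1 u := by
  have hdom : ∀ u : T.generator.domain, 0 ≤ (u : Lp ℝ 2 m) → MemLp (u : Lp ℝ 2 m) 1 m →
      ∀ v : Lp ℝ 2 m, 0 ≤ v → MemLp v 1 m → inner ℝ (T.op t u) v ≤
        inner ℝ (T₀.op t u) v + C * t * normL1 (u : Lp ℝ 2 m) * normL1 v := by
    intro u hu hu1 v hv hv1
    have h1 := (T₀.tendsto_smul_resolventOp (T.op t u)).inner (𝕜 := ℝ) (tendsto_const_nhds (x := v))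
    have h2 := ((((T₀.op t).continuous.tendsto _).comp
      (T₀.tendsto_smul_resolventOp (u : Lp ℝ 2 m))).inner (𝕜 := ℝ)
        (tendsto_const_nhds (x := v))).add_const (C * t * normL1 (u : Lp ℝ 2 m) * normL1 v)
    refine le_of_tendsto_of_tendsto h1 h2 ?_
    filter_upwards [eventually_gt_atTop 0, T₀.eventually_growthBoundLT] with l hl0 hl
    have h3 := inner_resolventOp_op_le hC hT₀ hT hT_contr hT₀_contr h hl0 hl hu hu1 hv hv1 t
    have h4 := mul_le_mul_of_nonneg_left h3 hl0.le
    have h5 : l * (C * normL1 (u : Lp ℝ 2 m) * (normL1 v / l) * t) =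
        C * t * normL1 (u : Lp ℝ 2 m) * normL1 v := by
      field_simp
    simp only [Function.comp, map_smul, real_inner_smul_left]
    linarith
  refine ae_le_add_of_inner_le (by have := normL1_nonneg u; positivity) fun v hv hv1 => ?_
  have h1 := (((T.op t).continuous.tendsto _).comp (T.tendsto_smul_resolventOp u)).inner (𝕜 := ℝ)
    (tendsto_const_nhds (x := v))
  have h2 := ((((T₀.op t).continuous.tendsto _).comp (T.tendsto_smul_resolventOp u)).inner (𝕜 := ℝ)
    (tendsto_const_nhds (x := v))).add_const (C * t * normL1 u * normL1 v)
  refine le_of_tendsto_of_tendsto h1 h2 ?_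
  filter_upwards [eventually_gt_atTop 0, T.eventually_growthBoundLT] with l hl0 hl
  obtain ⟨w, hw, -⟩ := (isResolventOp_resolventOp (T.mem_realResolventSet hl)).1 u
  have hw1 := hT.normL1_resolventOp_le hT_contr hl hl0 hu hu1
  have h3 := hdom w (by rw [hw]; exact hT.resolventOp_nonneg hl hu) (by rw [hw]; exact hw1.1) v hv hv1
  rw [hw] at h3
  -- The approximants l(l - A)⁻¹u of u have L₁ norm at most ‖u‖₁, so the constant C survives the
  -- limit.
  have h4 : C * t * normL1 (resolventOp T.generator l u) * normL1 v ≤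
      C * t * (normL1 u / l) * normL1 v := by
    have := normL1_nonneg v
    gcongr
    exact hw1.2
  have h5 := mul_le_mul_of_nonneg_left (h3.trans (add_le_add_right h4 _)) hl0.le
  have h6 : l * (C * t * (normL1 u / l) * normL1 v) = C * t * normL1 u * normL1 v := by
    field_simp
  simp only [Function.comp, map_smul, real_inner_smul_left]
  linarith

end Comparison

end C0Semigroup

theorem corollary2p4 {Ω : Type*} [MeasurableSpace Ω] (m : Measure Ω)
    (T₀ T : C0Semigroup (Lp ℝ 2 m)) (hT₀ : T₀.IsPositive) (hT : T.IsPositive)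
    (hT_contr : ∀ t : ℝ≥0, IsL1Contraction (T.op t))
    (hT₀_contr : ∀ t : ℝ≥0, IsL1Contraction (ContinuousLinearMap.adjoint (T₀.op t)))
    (C : ℝ) (hC : 0 ≤ C) :
    (∀ l : ℝ, T.GrowthBoundLT l → T₀.GrowthBoundLT l →
      l ∈ realResolventSet T.generator ∧ l ∈ realResolventSet T₀.generator) ∧
    List.TFAE [
      -- estimate for the semigroups
      ∀ (t : ℝ≥0) (u : Lp ℝ 2 m), 0 ≤ u → MemLp u 1 m →
        ∀ᵐ x ∂m, T.op t u x ≤ T₀.op t u x + C * t * normL1 u,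
      -- estimate for the generators
      ∀ (u : T.generator.domain) (v : T₀.generator.adjoint.domain),
        0 ≤ (u : Lp ℝ 2 m) → MemLp (u : Lp ℝ 2 m) 1 m →
        0 ≤ (v : Lp ℝ 2 m) → MemLp (v : Lp ℝ 2 m) 1 m →
        inner ℝ (T.generator u) (v : Lp ℝ 2 m) ≤
          inner ℝ (u : Lp ℝ 2 m) (T₀.generator.adjoint v) +
            C * normL1 (u : Lp ℝ 2 m) * normL1 (v : Lp ℝ 2 m),
      -- estimate for the resolvents in `L₂(m)`
      ∀ l : ℝ, 0 < l → T.GrowthBoundLT l → T₀.GrowthBoundLT l →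
        ∀ u : Lp ℝ 2 m, 0 ≤ u → MemLp u 1 m →
          ∀ᵐ x ∂m, resolventOp T.generator l u x ≤
            resolventOp T₀.generator l u x + C / l ^ 2 * normL1 u,
      -- the same estimate for all `l > 0`, for the resolvents extended as monotone limits
      ∀ l : ℝ, 0 < l → ∀ u : Lp ℝ 2 m, 0 ≤ u → MemLp u 1 m →
        ∀ᵐ x ∂m, T.laplaceLimit l u x ≤
          T₀.laplaceLimit l u x + ENNReal.ofReal (C / l ^ 2 * normL1 u)] := by
  refine ⟨fun l hl hl₀ => ⟨T.mem_realResolventSet hl, T₀.mem_realResolventSet hl₀⟩, ?_⟩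
  tfae_have 1 → 4 := fun h l hl u hu hu1 =>
    C0Semigroup.laplaceLimit_le_of_op_le hC h hl hu hu1
  tfae_have 4 → 3 := fun h l hl0 hl hl₀ u hu hu1 =>
    C0Semigroup.resolventOp_le_of_laplaceLimit_le hC hT₀ hT hl hl₀ hu (h l hl0 u hu hu1)
  tfae_have 3 → 2 := fun h => C0Semigroup.inner_generator_le_of_resolventOp_le h
  tfae_have 2 → 1 := fun h t u hu hu1 =>
    C0Semigroup.op_le_of_inner_generator_le hC hT₀ hT hT_contr hT₀_contr h t hu hu1
  tfae_finish
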